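/- A (non-associative) ring is an additive abelian group with a multiplication that is distributive over addition; associativity is not assumed. A left (right) ideal of a ring $S$ is an additive subgroup $I$ with $sx\in I$ (respectively $xs\in I$) for all $s\in S$, $x\in I$, and $S$ is left (right) artinian if its left (right) ideals satisfy the descending chain condition. Let $G$ be a groupoid, i.e. a small category in which every morphism is invertible. For a morphism $g$ let $d(g)$ and $c(g)$ be its domain and codomain, so that $gh$ is defined exactly when $d(g)=c(h)$. Call objects $e,f$ equivalent if there is a morphism from $e$ to $f$, and let $E$ be a set of representatives of the equivalence classes of objects (the connected components of $G$). For each $e\in E$ let $R_e$ be a unital, not necessarily associative, ring with $1\neq 0$. For $g\in\mathrm{mor}(G)$ let $e(g)$ be the unique element of $E$ equivalent to $c(g)$, and put $R_g=R_{e(g)}$. The groupoid ring $R[G]$ is the set of all finite formal sums $\sum_{g\in\mathrm{mor}(G)} r_g\delta_g$ with $r_g\in R_g$, with componentwise addition and the biadditive multiplication determined by $(r\delta_g)(r'\delta_h)=(rr')\delta_{gh}$ if $d(g)=c(h)$ (in which case $R_g=R_h=R_{gh}$) and $(r\delta_g)(r'\delta_h)=0$ otherwise. **Theorem.** The ring $R[G]$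 is left artinian if and only if $\mathrm{mor}(G)$ is finite and $R_e$ is left artinian for every $e\in E$. Likewise, $R[G]$ is right artinian if and only if $\mathrm{mor}(G)$ is finite and $R_e$ is right artinian for every $e\in E$. -/

import Mathlib

open CategoryTheory

universe u v w

/-- A left ideal of a (not necessarily associative, not necessarily unital) ring `S`: an additive
subgroup `I` with `S I ⊆ I`, i.e. a left `S`-submodule of `S`. -/
def IsLeftIdeal {S : Type w} [NonUnitalNonAssocRing S] (I : AddSubgroup S) : Prop :=
  ∀ s x : S, x ∈ I → s * x ∈ I

/-- A right ideal of a (not necessarily associative, not necessarily unital) ring `S`: an additive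
subgroup `I` with `I S ⊆ I`. -/
def IsRightIdeal {S : Type w} [NonUnitalNonAssocRing S] (I : AddSubgroup S) : Prop :=
  ∀ s x : S, x ∈ I → x * s ∈ I

/-- `S` is left artinian: the poset of its left ideals satisfies the descending chain condition. -/
def IsLeftArtinian (S : Type w) [NonUnitalNonAssocRing S] : Prop :=
  WellFoundedLT {I : AddSubgroup S // IsLeftIdeal I}

/-- `S` is right artinian: the poset of its right ideals satisfies the descending chain
condition. -/
def IsRightArtinian (S : Type w) [NonUnitalNonAssocRing S] : Prop :=
  WellFoundedLT {I : AddSubgroup S // IsRightIdeal I}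

/-- The set `mor(G)` of all morphisms of the groupoid `G`. For `g : Mor G`, the domain `d(g)` is
`g.left`, the codomain `c(g)` is `g.right`, and `g.hom : g.left ⟶ g.right`. -/
abbrev Mor (G : Type u) [Groupoid.{v} G] : Type (max u v) := Quiver.Total G

/-- The product `gh` (first `h`, then `g`) of a composable pair, `d(g) = c(h)`. -/
def Mor.comp {G : Type u} [Groupoid.{v} G] (g h : Mor G) (hgh : g.left = h.right) : Mor G :=
  ⟨h.left, g.right, h.hom ≫ eqToHom hgh.symm ≫ g.hom⟩

/-- `E` is a set of representatives for the connected components of `G`, i.e. for the equivalence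
relation on `ob(G)` given by `c ∼ e` iff there is a morphism from `c` to `e`. -/
def IsRepresentatives {G : Type u} [Groupoid.{v} G] (E : Set G) : Prop :=
  ∀ c : G, ∃! e : G, e ∈ E ∧ Nonempty (c ⟶ e)

namespace IsRepresentatives

variable {G : Type u} [Groupoid.{v} G] {E : Set G}

/-- The unique element of `E` in the connected component of the object `c`. -/
noncomputable def rep (hE : IsRepresentatives E) (c : G) : E :=
  ⟨(hE c).choose, (hE c).choose_spec.1.1⟩

theorem nonempty_hom_rep (hE : IsRepresentatives E) (c : G) :
    Nonempty (c ⟶ (hE.rep c : G)) :=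
  (hE c).choose_spec.1.2

theorem rep_eq_of_hom (hE : IsRepresentatives E) {a b : G} (f : a ⟶ b) :
    hE.rep a = hE.rep b :=
  Subtype.ext ((hE a).unique ⟨(hE.rep a).2, hE.nonempty_hom_rep a⟩
    ⟨(hE.rep b).2, (hE.nonempty_hom_rep b).map fun k => f ≫ k⟩)

/-- `e(g)`, the representative of the connected component containing `g` (that is, containing
`c(g)`). -/
noncomputable def repMor (hE : IsRepresentatives E) (g : Mor G) : E :=
  hE.rep g.right

theorem repMor_eq (hE : IsRepresentatives E) {g h : Mor G} (hgh : g.left = h.right) :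
    hE.repMor h = hE.repMor g :=
  (congrArg hE.rep hgh.symm).trans (hE.rep_eq_of_hom g.hom)

end IsRepresentatives

/-- The underlying additive group of the groupoid ring `R[G]`: finite formal sums
`∑ r_g δ_g` over `g ∈ mor(G)`, where `r_g ∈ R_g := R_{e(g)}`. -/
def GroupoidRing {G : Type u} [Groupoid.{v} G] {E : Set G} (hE : IsRepresentatives E)
    (R : E → Type w) [∀ e, NonAssocRing (R e)] : Type (max u v w) :=
  DirectSum (Mor G) fun g => R (hE.repMor g)

namespace GroupoidRing

variable {G : Type u} [Groupoid.{v} G] {E : Set G} (hE : IsRepresentatives E)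
  (R : E → Type w) [∀ e, NonAssocRing (R e)]

noncomputable instance instAddCommGroup : AddCommGroup (GroupoidRing hE R) :=
  inferInstanceAs (AddCommGroup (DirectSum (Mor G) fun g => R (hE.repMor g)))

open Classical in
/-- The element `r δ_g`, additively in `r ∈ R_g`. -/
noncomputable def single (g : Mor G) : R (hE.repMor g) →+ GroupoidRing hE R :=
  DirectSum.of (fun g : Mor G => R (hE.repMor g)) g

open Classical in
/-- The additive map out of `R[G]` with prescribed values on homogeneous elements. -/
noncomputable def liftHom {A : Type*} [AddCommGroup A] (φ : ∀ g : Mor G, R (hE.repMor g) →+ A) :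
    GroupoidRing hE R →+ A :=
  DirectSum.toAddMonoid (β := fun g : Mor G => R (hE.repMor g)) φ

theorem liftHom_single {A : Type*} [AddCommGroup A] (φ : ∀ g : Mor G, R (hE.repMor g) →+ A)
    (g : Mor G) (r : R (hE.repMor g)) : liftHom hE R φ (single hE R g r) = φ g r := by
  classical
  exact DirectSum.toAddMonoid_of (β := fun g : Mor G => R (hE.repMor g)) φ g r

open Classical in
/-- The product of homogeneous elements: `(r δ_g) (r' δ_h) = (r r') δ_{gh}` if `g` and `h` are
composable, and `0` otherwise. For composable `g, h` the rings `R_g`, `R_h` and `R_{gh}` are the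
same ring, since `e(g) = e(h) = e(gh)`; the cast expresses this identification. -/
noncomputable def mulSingle (g h : Mor G) :
    R (hE.repMor g) →+ R (hE.repMor h) →+ GroupoidRing hE R :=
  if hgh : g.left = h.right then
    (AddMonoidHom.mul.compl₂
      (RingEquiv.cast (R := R) (hE.repMor_eq hgh)).toAddEquiv.toAddMonoidHom).compr₂
      (single hE R (g.comp h hgh))
  else 0

/-- The multiplication of `R[G]`, the biadditive extension of `mulSingle`. -/
noncomputable def mulHom : GroupoidRing hE R →+ GroupoidRing hE R →+ GroupoidRing hE R :=
  liftHom hE R fun g => (liftHom hE R fun h => (mulSingle hE R g h).flip).flip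

/-- The groupoid ring `R[G]`, a non-associative ring (unital only if `G` has finitely many
objects). -/
noncomputable instance instNonUnitalNonAssocRing : NonUnitalNonAssocRing (GroupoidRing hE R) where
  __ := instAddCommGroup hE R
  mul x y := mulHom hE R x y
  left_distrib x y z := map_add (mulHom hE R x) y z
  right_distrib x y z := by
    change mulHom hE R (x + y) z = mulHom hE R x z + mulHom hE R y z
    rw [map_add, AddMonoidHom.add_apply]
  zero_mul x := by
    change mulHom hE R 0 x = 0
    rw [map_zero, AddMonoidHom.zero_apply]
  mul_zero x := map_zero (mulHom hE R x)

theorem single_mul_single_eq_mulSingle (g h : Mor G) (r : R (hE.repMor g))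
    (r' : R (hE.repMor h)) :
    single hE R g r * single hE R h r' = mulSingle hE R g h r r' := by
  change mulHom hE R (single hE R g r) (single hE R h r') = _
  rw [mulHom, liftHom_single, AddMonoidHom.flip_apply, liftHom_single, AddMonoidHom.flip_apply]

/-- `(r δ_g) (r' δ_h) = (r r') δ_{gh}` for composable `g, h`. -/
theorem single_mul_single (g h : Mor G) (hgh : g.left = h.right) (r : R (hE.repMor g))
    (r' : R (hE.repMor h)) :
    single hE R g r * single hE R h r' =
      single hE R (g.comp h hgh) (r * RingEquiv.cast (R := R) (hE.repMor_eq hgh) r') := by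
  rw [single_mul_single_eq_mulSingle, mulSingle, dif_pos hgh]
  rfl

/-- `(r δ_g) (r' δ_h) = 0` if `g, h` are not composable. -/
theorem single_mul_single_of_ne (g h : Mor G) (hgh : g.left ≠ h.right) (r : R (hE.repMor g))
    (r' : R (hE.repMor h)) :
    single hE R g r * single hE R h r' = 0 := by
  rw [single_mul_single_eq_mulSingle, mulSingle, dif_neg hgh]
  rfl

end GroupoidRing

/-! A strictly increasing map from one poset to another pulls the descending chain condition back,
so each finiteness claim comes from a strictly monotone family of left ideals of `R[G]`. A left
ideal of `R e` gives the elements whose coefficients in `R e` lie in it, so `R e` is artinian. A set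
of objects gives the elements supported on morphisms with domain in it, so there are finitely many
objects (`finite_objects`).

The hard point is that a vertex group `End a` is finite. Since the coefficients need not be
associative or contain a field, they are probed only by additive maps `φ` into a field `F`, chosen
so that some `φ` has `φ 1 ≠ 0`. Each left ideal of the group algebra of `End a` over `F` is pulled
back along all these maps, which makes that group algebra artinian (`finite_end`). An artinian group
algebra over a field forces the group to be finite (`finite_of_isArtinianRing_monoidAlgebra`): a
power of a suitable element of augmentation 1 generates a finite-dimensional right ideal.

Conversely, for finite `Mor G`, a left ideal within a larger one is determined by its leading
coefficients along an enumeration of the morphisms. The right-hand statement follows through the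
anti-isomorphism given by inverting morphisms. -/

/-! ### Augmented artinian algebras and group algebras -/

section Augmentation

variable {F A : Type*} [Field F] [Ring A] [Algebra F A]

/-- If `ε a ≠ 0`, then `1 - (ε a)⁻¹ a` has a left inverse although `ε` kills it. -/
theorem jacobson_le_ker_augmentation (ε : A →ₐ[F] F) {a : A} (ha : a ∈ Ring.jacobson A) :
    ε a = 0 := by
  by_contra h
  rw [← Ideal.jacobson_bot, Ideal.mem_jacobson_iff] at ha
  obtain ⟨z, hz⟩ := ha (algebraMap F A (-(ε a)⁻¹))
  have := congrArg ε (Ideal.mem_bot.mp hz)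
  simp only [map_sub, map_add, map_mul, AlgHom.commutes, map_one, map_zero, Algebra.algebraMap_self,
    RingHom.id_apply] at this
  field_simp at this
  simp at this

variable [IsArtinianRing A]

/-- Modulo the radical the algebra is semisimple, so the image `W` of `ker ε` has a complement `C`.
The `C`-component `u` of 1 works: `a * u` falls into `W ⊓ C` when `ε a = 0`. -/
theorem exists_augmentation_eq_one_ker_mul_mem_jacobson (ε : A →ₐ[F] F) :
    ∃ u : A, ε u = 1 ∧ ∀ a, ε a = 0 → a * u ∈ Ring.jacobson A := by
  let π := Ideal.Quotient.mk (Ring.jacobson A)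
  let W : Ideal (A ⧸ Ring.jacobson A) := (RingHom.ker ε).map π
  have hW : ∀ a, π a ∈ W → ε a = 0 := by
    intro a ha
    obtain ⟨b, hb, hab⟩ :=
      (Ideal.mem_map_iff_of_surjective π Ideal.Quotient.mk_surjective).mp ha
    have h := jacobson_le_ker_augmentation ε (Ideal.Quotient.eq.mp hab)
    rw [map_sub, (RingHom.mem_ker).mp hb, zero_sub, neg_eq_zero] at h
    exact h
  have hW' : ∀ a, ε a = 0 → π a ∈ W := fun a ha => Ideal.mem_map_of_mem π ha
  obtain ⟨C, hC⟩ := exists_isCompl W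
  have h1 : (1 : A ⧸ Ring.jacobson A) ∈ W ⊔ C := by rw [hC.sup_eq_top]; trivial
  obtain ⟨w, hw, c, hc, hwc⟩ := Submodule.mem_sup.mp h1
  obtain ⟨u, rfl⟩ := Ideal.Quotient.mk_surjective c
  obtain ⟨w, rfl⟩ := Ideal.Quotient.mk_surjective w
  refine ⟨u, ?_, fun a ha => ?_⟩
  · have h := jacobson_le_ker_augmentation ε
      (Ideal.Quotient.eq.mp ((map_add π w u).trans (hwc.trans (map_one π).symm)))
    rw [map_sub, map_add, hW w hw, map_one, zero_add, sub_eq_zero] at h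
    exact h
  · have h2 : π (a * u) ∈ W ⊓ C :=
      ⟨hW' _ (by rw [map_mul, ha, zero_mul]), by rw [map_mul]; exact C.mul_mem_left _ hc⟩
    rw [hC.inf_eq_bot] at h2
    exact Ideal.Quotient.eq_zero_iff_mem.mp h2

/-- The radical is nilpotent, hence so is each `y * x`, and `1 + y * x` is a unit. -/
theorem mem_jacobson_of_forall_mul_sq_mem {A : Type*} [Ring A] [IsArtinianRing A] {x : A}
    (hx : ∀ y, (y * x) ^ 2 ∈ Ring.jacobson A) : x ∈ Ring.jacobson A := by
  obtain ⟨n, hn⟩ := IsSemiprimaryRing.isNilpotent (R := A)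
  rw [← Ideal.jacobson_bot, Ideal.mem_jacobson_iff]
  intro y
  have hnil : IsNilpotent (y * x) := by
    refine ⟨2 * n, ?_⟩
    have h := Ideal.pow_mem_pow (hx y) n
    rw [hn] at h
    rw [pow_mul]
    exact h
  obtain ⟨z, hz⟩ := hnil.isUnit_one_add.exists_left_inv
  refine ⟨z, ?_⟩
  rw [Ideal.mem_bot, ← hz]
  noncomm_ring

/-- An augmented artinian algebra over a field has a nonzero finite-dimensional right ideal. -/
theorem exists_augmentation_eq_one_finite_range_mulLeft (ε : A →ₐ[F] F) :
    ∃ x : A, ε x = 1 ∧ ∃ V : Submodule F A, Module.Finite F V ∧ ∀ a, x * a ∈ V := by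
  obtain ⟨u, hu, hωu⟩ := exists_augmentation_eq_one_ker_mul_mem_jacobson ε
  have huω : ∀ a, ε a = 0 → u * a ∈ Ring.jacobson A := by
    refine fun a ha => mem_jacobson_of_forall_mul_sq_mem fun y => ?_
    -- The middle factor lies in the radical because `ε (a * y) = 0`. This transfers the property of
    -- `u` from one side to the other.
    have h : (y * (u * a)) ^ 2 = (y * u) * ((a * y) * u) * a := by noncomm_ring
    rw [h]
    exact Ideal.mul_mem_right _ _ (Ideal.mul_mem_left _ _ (hωu _ (by rw [map_mul, ha, zero_mul])))
  obtain ⟨J, hJ⟩ : ∃ J : Ideal A, J = Ring.jacobson A := ⟨_, rfl⟩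
  rw [← hJ] at huω
  have : J.IsTwoSided := hJ ▸ inferInstance
  -- Up to a finite-dimensional error, `u ^ i` maps the algebra into `J ^ i`; for `i` the nilpotency
  -- index of `J` only the error remains.
  have step : ∀ i : ℕ, ∃ V : Submodule F A, Module.Finite F V ∧
      ∀ a, ∃ j ∈ J ^ i, u ^ i * a - j ∈ V := by
    intro i
    induction i with
    | zero => exact ⟨⊥, inferInstance, fun a => ⟨a, by rw [Submodule.pow_zero, Ideal.one_eq_top]; trivial, by simp⟩⟩
    | succ i ih =>
      obtain ⟨V, hV, h⟩ := ih
      obtain ⟨s, hs⟩ := (IsNoetherian.noetherian (J ^ i) : Submodule.FG _)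
      let Ls : Submodule F A := Submodule.span F ((fun m => u * m) '' (s : Set A))
      have hLs : Module.Finite F Ls :=
        Module.Finite.span_of_finite F (s.finite_toSet.image _)
      -- For a generator `m` of `J ^ i`, `u * (a * m)` is congruent to `ε a • (u * m)` modulo `J ^
      -- (i + 1)`, since `u * (a - ε a)` lies in `J`. Finitely many generators thus span the error.
      have key : ∀ j ∈ J ^ i, ∀ a, ∃ j' ∈ J ^ (i + 1),
          u * (a * j) - j' ∈ Ls := by
        intro j hj
        rw [← hs] at hj
        induction hj using Submodule.span_induction with
        | zero => exact fun a => ⟨0, Submodule.zero_mem _, by simp⟩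
        | add x y _ _ hx hy =>
          intro a
          obtain ⟨x', hx', hx⟩ := hx a
          obtain ⟨y', hy', hy⟩ := hy a
          refine ⟨x' + y', Submodule.add_mem _ hx' hy', ?_⟩
          have : u * (a * (x + y)) - (x' + y') = (u * (a * x) - x') + (u * (a * y) - y') := by
            noncomm_ring
          rw [this]
          exact Submodule.add_mem _ hx hy
        | smul b x _ hx => simpa only [smul_eq_mul, mul_assoc] using fun a => hx (a * b)
        | mem m hm =>
          intro a
          refine ⟨u * (a - algebraMap F A (ε a)) * m, ?_, ?_⟩
          · rw [Ideal.IsTwoSided.pow_succ]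
            refine Ideal.mul_mem_mul (huω _ ?_) (hs ▸ Submodule.subset_span hm)
            simp
          · have : u * (a * m) - u * (a - algebraMap F A (ε a)) * m = ε a • (u * m) := by
              rw [Algebra.smul_def, ← mul_assoc, ← sub_mul, ← mul_sub, sub_sub_cancel,
                ← Algebra.commutes, mul_assoc]
            rw [this]
            exact Submodule.smul_mem _ _ (Submodule.subset_span ⟨m, hm, rfl⟩)
      refine ⟨V.map (LinearMap.mulLeft F u) ⊔ Ls, inferInstance, fun a => ?_⟩
      obtain ⟨j, hj, hja⟩ := h a
      obtain ⟨j', hj', hjj⟩ := key j hj 1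
      rw [one_mul] at hjj
      refine ⟨j', hj', ?_⟩
      have : u ^ (i + 1) * a - j' = u * (u ^ i * a - j) + (u * j - j') := by
        rw [pow_succ']; noncomm_ring
      rw [this]
      exact Submodule.add_mem_sup ⟨_, hja, rfl⟩ hjj
  obtain ⟨n, hn⟩ := IsSemiprimaryRing.isNilpotent (R := A)
  rw [← hJ] at hn
  obtain ⟨V, hV, h⟩ := step n
  refine ⟨u ^ n, by rw [map_pow, hu, one_pow], V, hV, fun a => ?_⟩
  obtain ⟨j, hj, hja⟩ := h a
  rw [hn] at hj
  rwa [(hj : j = 0), sub_zero] at hja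

end Augmentation

/-- A group whose group algebra over a field is left artinian is finite. -/
theorem finite_of_isArtinianRing_monoidAlgebra (F H : Type*) [Field F] [Group H]
    [IsArtinianRing (MonoidAlgebra F H)] : Finite H := by
  classical
  obtain ⟨x, hx, V, hV, hxV⟩ :=
    exists_augmentation_eq_one_finite_range_mulLeft (MonoidAlgebra.lift F F H 1)
  have hx0 : x.coeff ≠ 0 := by
    intro h
    have : x = 0 := MonoidAlgebra.coeff_injective h
    rw [this, map_zero] at hx
    exact zero_ne_one hx
  obtain ⟨t, ht⟩ := Finsupp.support_nonempty_iff.mpr hx0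
  obtain ⟨s, hs⟩ := Module.Finite.iff_fg.mp hV
  let T : Finset H := s.biUnion fun y => y.coeff.support
  have hT : ∀ y ∈ V, y.coeff.support ⊆ T := by
    intro y hy
    rw [← hs] at hy
    induction hy using Submodule.span_induction with
    | mem y hy => exact Finset.subset_biUnion_of_mem (fun y : MonoidAlgebra F H => y.coeff.support) hy
    | zero => simp
    | add y z _ _ hy hz =>
      rw [MonoidAlgebra.coeff_add]
      exact Finsupp.support_add.trans (Finset.union_subset hy hz)
    | smul c y _ hy =>
      rw [MonoidAlgebra.coeff_smul]
      exact Finsupp.support_smul.trans hy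
  -- Right multiplication of `x` by `h` moves the support point `t` to `t * h`, so the translate `t
  -- H` lies in the finite set `T`.
  refine Finite.of_injective (fun h : H => (⟨t * h, ?_⟩ : T)) fun h k hk => ?_
  · refine hT _ (hxV (MonoidAlgebra.single h 1)) ?_
    rw [Finsupp.mem_support_iff, MonoidAlgebra.coeff_mul_single_apply]
    simpa using ht
  · exact mul_left_cancel (Subtype.ext_iff.mp hk)

/-! ### Additive maps from a nonassociative ring to a field -/

/-- A ring has integral multiples if finitely many of its elements can be simultaneously multiplied
into the image of `ℤ` by a nonzero factor. -/
def HasIntegralMultiples (F : Type*) [Ring F] : Prop :=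
  ∀ s : Finset F, ∃ n : F, n ≠ 0 ∧ ∀ c ∈ s, ∃ z : ℤ, n * c = z

theorem hasIntegralMultiples_rat : HasIntegralMultiples ℚ := by
  intro s
  obtain ⟨b, hb⟩ := IsLocalization.exist_integer_multiples_of_finset (nonZeroDivisors ℤ) s
  refine ⟨(b : ℤ), by exact_mod_cast nonZeroDivisors.coe_ne_zero b, fun c hc => ?_⟩
  obtain ⟨z, hz⟩ := hb c hc
  refine ⟨z, ?_⟩
  have h : (z : ℚ) = (b : ℤ) • c := hz
  rw [h, zsmul_eq_mul]

theorem hasIntegralMultiples_zmod (p : ℕ) [Fact p.Prime] : HasIntegralMultiples (ZMod p) :=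
  fun _ => ⟨1, one_ne_zero, fun c _ =>
    let ⟨z, hz⟩ := ZMod.intCast_surjective c
    ⟨z, by rw [one_mul, hz]⟩⟩

theorem exists_nsmul_eq_one {R : Type*} [NonAssocRing R]
    (h : ∀ p : ℕ, p.Prime → ∃ r : R, p • r = 1) (n : ℕ) (hn : n ≠ 0) : ∃ r : R, n • r = 1 := by
  induction n using Nat.recOnMul with
  | zero => exact absurd rfl hn
  | one => exact ⟨1, one_nsmul 1⟩
  | prime p hp => exact h p hp
  | mul a b iha ihb =>
    obtain ⟨r, hr⟩ := iha (left_ne_zero_of_mul hn)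
    obtain ⟨s, hs⟩ := ihb (right_ne_zero_of_mul hn)
    refine ⟨r * s, ?_⟩
    rw [mul_nsmul, ← smul_mul_assoc, hr, one_mul, hs]

theorem Module.exists_addMonoidHom_apply_ne_zero (F : Type*) [Field F] {V : Type*} [AddCommGroup V]
    [Module F V] {v : V} (hv : v ≠ 0) : ∃ φ : V →+ F, φ v ≠ 0 :=
  let ⟨f, hf⟩ := Module.Projective.exists_dual_ne_zero F hv
  ⟨f.toAddMonoidHom, hf⟩

theorem exists_addMonoidHom_zmod_apply_ne_zero (p : ℕ) [Fact p.Prime] {V : Type*} [AddCommGroup V]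
    (hV : ∀ x : V, p • x = 0) {v : V} (hv : v ≠ 0) : ∃ φ : V →+ ZMod p, φ v ≠ 0 := by
  let _ : Module (ZMod p) V := AddCommGroup.zmodModule hV
  exact Module.exists_addMonoidHom_apply_ne_zero (ZMod p) hv

/-- If every prime divides 1, then 1 has infinite additive order, and `ℤ → ℚ` extends to `R` because
`ℚ` is divisible. Otherwise 1 survives in the `ZMod p`-vector space `R / pR` for some prime `p`, and
a linear functional detects it. -/
theorem exists_addMonoidHom_field_map_one_ne_zero (R : Type*) [NonAssocRing R] [Nontrivial R] :
    ∃ (F : Type) (_ : Field F), HasIntegralMultiples F ∧ ∃ φ : R →+ F, φ 1 ≠ 0 := by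
  by_cases h : ∀ p : ℕ, p.Prime → ∃ r : R, p • r = 1
  · refine ⟨ℚ, inferInstance, hasIntegralMultiples_rat, ?_⟩
    have hinj : Function.Injective (zmultiplesHom R (1 : R)) := by
      rw [injective_iff_map_eq_zero]
      intro z hz
      by_contra hz0
      obtain ⟨r, hr⟩ := exists_nsmul_eq_one h z.natAbs (Int.natAbs_ne_zero.mpr hz0)
      have h1 : (z.natAbs : ℤ) • (1 : R) = 0 := by
        rcases Int.natAbs_eq z with hz' | hz' <;> rw [zmultiplesHom_apply, hz'] at hz
        · exact hz
        · rwa [neg_smul, neg_eq_zero] at hz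
      rw [natCast_zsmul] at h1
      have h2 : z.natAbs • r = 0 := by
        rw [← one_mul r, ← smul_mul_assoc, h1, zero_mul]
      exact one_ne_zero (hr.symm.trans h2)
    obtain ⟨φ, hφ⟩ := (Module.Baer.of_divisible ℚ).extension_property_addMonoidHom
      (zmultiplesHom R (1 : R)) hinj (Int.castAddHom ℚ)
    refine ⟨φ, ?_⟩
    have := DFunLike.congr_fun hφ (1 : ℤ)
    simp at this
    simp [this]
  · push Not at h
    obtain ⟨p, hp, h⟩ := h
    have := Fact.mk hp
    refine ⟨ZMod p, inferInstance, hasIntegralMultiples_zmod p, ?_⟩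
    let P : AddSubgroup R := (nsmulAddMonoidHom p : R →+ R).range
    have h1 : (QuotientAddGroup.mk (1 : R) : R ⧸ P) ≠ 0 := by
      rw [Ne, QuotientAddGroup.eq_zero_iff]
      rintro ⟨r, hr⟩
      exact h r hr
    obtain ⟨f, hf⟩ := exists_addMonoidHom_zmod_apply_ne_zero p
      (fun y => QuotientAddGroup.induction_on y fun x =>
        (QuotientAddGroup.eq_zero_iff _).mpr ⟨x, rfl⟩) h1
    exact ⟨f.comp (QuotientAddGroup.mk' P), hf⟩

/-! ### Composition, division and representatives of morphisms -/

namespace Mor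

variable {G : Type u} [Groupoid.{v} G]

/-- The inverse of a morphism, as an element of `Mor G`. -/
def inv (g : Mor G) : Mor G := ⟨g.right, g.left, Groupoid.inv g.hom⟩

/-- The quotient `g⁻¹ m` of two morphisms with the same codomain. -/
def leftDiv (g m : Mor G) (hmg : m.right = g.right) : Mor G :=
  ⟨m.left, g.left, m.hom ≫ eqToHom hmg ≫ Groupoid.inv g.hom⟩

/-- The identity morphism of an object, as an element of `Mor G`. -/
def id (a : G) : Mor G := ⟨a, a, 𝟙 a⟩

theorem comp_mk {a b c : G} (f : b ⟶ c) (k : a ⟶ b) :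
    Mor.comp (⟨b, c, f⟩ : Mor G) ⟨a, b, k⟩ rfl = ⟨a, c, k ≫ f⟩ := by
  simp [Mor.comp]

theorem comp_eq_iff (g h m : Mor G) (hgh : g.left = h.right) (hmg : m.right = g.right) :
    g.comp h hgh = m ↔ h = g.leftDiv m hmg := by
  obtain ⟨c, d, g⟩ := g
  obtain ⟨a, b, h⟩ := h
  obtain ⟨a', b', m⟩ := m
  dsimp only at hgh hmg
  subst hgh hmg
  simp only [leftDiv, comp_mk]
  constructor
  · intro h1
    cases h1
    simp
  · intro h1
    cases h1
    simp

theorem id_leftDiv (a : G) (m : Mor G) (hm : m.right = (id a).right) : (id a).leftDiv m hm = m := by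
  obtain ⟨_, _, m⟩ := m
  change _ = a at hm
  subst hm
  simp [leftDiv, id]

theorem inv_inv (g : Mor G) : g.inv.inv = g := by
  obtain ⟨a, b, g⟩ := g
  simp [inv]

theorem inv_comp (g h : Mor G) (hgh : g.left = h.right) :
    (g.comp h hgh).inv = h.inv.comp g.inv (show h.inv.left = g.inv.right from hgh.symm) := by
  obtain ⟨b, c, g⟩ := g
  obtain ⟨a, b', h⟩ := h
  dsimp only at hgh
  subst hgh
  simp [inv, Mor.comp]

end Mor

namespace IsRepresentatives

variable {G : Type u} [Groupoid.{v} G] {E : Set G} (hE : IsRepresentatives E)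

theorem repMor_comp (g h : Mor G) (hgh : g.left = h.right) :
    hE.repMor (g.comp h hgh) = hE.repMor g := rfl

theorem repMor_inv (g : Mor G) : hE.repMor g.inv = hE.repMor g :=
  hE.rep_eq_of_hom g.hom

theorem repMor_leftDiv (g m : Mor G) (hmg : m.right = g.right) :
    hE.repMor (g.leftDiv m hmg) = hE.repMor g :=
  hE.rep_eq_of_hom g.hom

theorem repMor_eq_of_right_eq {g m : Mor G} (hmg : m.right = g.right) :
    hE.repMor g = hE.repMor m :=
  congrArg hE.rep hmg.symm

theorem repMor_mk {a b : G} (f : a ⟶ b) : hE.repMor ⟨a, b, f⟩ = hE.rep a :=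
  (hE.rep_eq_of_hom f).symm

theorem rep_coe (e : E) : hE.rep (e : G) = e :=
  Subtype.ext ((hE e).unique ⟨(hE.rep e).2, hE.nonempty_hom_rep e⟩ ⟨e.2, ⟨𝟙 _⟩⟩)

end IsRepresentatives

/-! ### Homogeneous elements and coefficients -/

namespace GroupoidRing

variable {G : Type u} [Groupoid.{v} G] {E : Set G} (hE : IsRepresentatives E)
  (R : E → Type w) [∀ e, NonAssocRing (R e)]

/-- The element `r δ_g` with coefficient `r` in `R e`, where `e = e(g)` propositionally. -/
noncomputable def term (e : E) (g : Mor G) (hg : hE.repMor g = e) : R e →+ GroupoidRing hE R :=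
  (single hE R g).comp (RingEquiv.cast (R := R) hg.symm).toAddEquiv.toAddMonoidHom

open Classical in
/-- The coefficient at `g`, as an element of `R e`, where `e = e(g)` propositionally. -/
noncomputable def coeff (e : E) (g : Mor G) (hg : hE.repMor g = e) : GroupoidRing hE R →+ R e :=
  liftHom hE R fun h => if hgh : h = g then
    (RingEquiv.cast (R := R) (by rw [hgh, hg])).toAddEquiv.toAddMonoidHom else 0

theorem term_rfl (g : Mor G) (r : R (hE.repMor g)) :
    term hE R (hE.repMor g) g rfl r = single hE R g r := rfl

@[elab_as_elim]
theorem induction {P : GroupoidRing hE R → Prop} (zero : P 0)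
    (add : ∀ x y, P x → P y → P (x + y))
    (term : ∀ e g hg r, P (term hE R e g hg r)) (x : GroupoidRing hE R) : P x := by
  classical
  exact DirectSum.induction_on (β := fun g : Mor G => R (hE.repMor g)) x zero
    (fun g r => term _ g rfl r) add

theorem term_mul_term (e : E) (g h : Mor G) (hg : hE.repMor g = e) (hh : hE.repMor h = e)
    (hgh : g.left = h.right) (r r' : R e) :
    term hE R e g hg r * term hE R e h hh r' = term hE R e (g.comp h hgh)
      ((hE.repMor_comp g h hgh).trans hg) (r * r') := by
  subst hg
  rw [term_rfl, term, AddMonoidHom.comp_apply, single_mul_single hE R g h hgh]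
  have key : ∀ (e e' : E) (p : e' = e) (q : e = e') (r : R e),
      RingEquiv.cast (R := R) p (RingEquiv.cast (R := R) q r) = r := by
    rintro e _ _ rfl r
    rfl
  exact congrArg (fun z : R (hE.repMor g) => term hE R (hE.repMor g) (g.comp h hgh)
    (hE.repMor_comp g h hgh) (r * z)) (key _ _ (hE.repMor_eq hgh) hh.symm r')

theorem term_mul_term_of_ne (e e' : E) (g h : Mor G) (hg : hE.repMor g = e)
    (hh : hE.repMor h = e') (hgh : g.left ≠ h.right) (r : R e) (r' : R e') :
    term hE R e g hg r * term hE R e' h hh r' = 0 :=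
  single_mul_single_of_ne hE R g h hgh _ _

theorem coeff_term_self (e : E) (g : Mor G) (hg : hE.repMor g = e) (r : R e) :
    coeff hE R e g hg (term hE R e g hg r) = r := by
  subst hg
  rw [term_rfl, coeff, liftHom_single, dif_pos rfl]
  rfl

theorem coeff_term_of_ne (e e' : E) (g h : Mor G) (hg : hE.repMor g = e) (hh : hE.repMor h = e')
    (hgh : h ≠ g) (r : R e') : coeff hE R e g hg (term hE R e' h hh r) = 0 := by
  subst hh
  rw [term_rfl, coeff, liftHom_single, dif_neg hgh]
  rfl

theorem coeff_congr (e : E) {g h : Mor G} (hg : hE.repMor g = e) (hgh : g = h)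
    (x : GroupoidRing hE R) : coeff hE R e g hg x = coeff hE R e h (hgh ▸ hg) x := by
  subst hgh
  rfl

theorem coeff_rfl_apply (g : Mor G) (x : GroupoidRing hE R) :
    coeff hE R (hE.repMor g) g rfl x =
      DFinsupp.toFun (β := fun g : Mor G => R (hE.repMor g)) x g := by
  classical
  induction x using GroupoidRing.induction with
  | zero => rw [map_zero]; rfl
  | add x y hx hy => rw [map_add, hx, hy]; rfl
  | term e h hh r =>
    subst hh
    by_cases hgh : h = g
    · subst hgh
      rw [coeff_term_self]
      exact (DirectSum.of_eq_same (β := fun g : Mor G => R (hE.repMor g)) h r).symm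
    · rw [coeff_term_of_ne _ _ _ _ _ _ _ _ hgh]
      exact (DirectSum.of_eq_of_ne (β := fun g : Mor G => R (hE.repMor g)) h g r (Ne.symm hgh)).symm

theorem ext_coeff {x y : GroupoidRing hE R}
    (h : ∀ g, coeff hE R (hE.repMor g) g rfl x = coeff hE R (hE.repMor g) g rfl y) : x = y := by
  refine DFinsupp.ext (β := fun g : Mor G => R (hE.repMor g)) fun g => ?_
  have := h g
  rwa [coeff_rfl_apply, coeff_rfl_apply] at this

theorem finite_setOf_coeff_ne_zero (x : GroupoidRing hE R) :
    {g | ∃ e hg, coeff hE R e g hg x ≠ 0}.Finite := by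
  induction x using GroupoidRing.induction with
  | zero => simp
  | add x y hx hy =>
    refine (hx.union hy).subset ?_
    rintro g ⟨e, hg, h⟩
    by_contra hn
    simp only [Set.mem_union, Set.mem_ofPred_eq, not_or, not_exists, not_not] at hn
    exact h (by rw [map_add, hn.1, hn.2, add_zero])
  | term e h hh r =>
    refine (Set.finite_singleton h).subset ?_
    rintro g ⟨e', hg, hne⟩
    by_contra hn
    exact hne (coeff_term_of_ne _ _ _ _ _ _ _ _ (Ne.symm hn) _)

/-- Only `h = g⁻¹ m` satisfies `g h = m`, so a single coefficient of `x` contributes. -/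
theorem coeff_term_mul (e : E) (g m : Mor G) (hg : hE.repMor g = e) (hm : hE.repMor m = e)
    (hmg : m.right = g.right) (r : R e) (x : GroupoidRing hE R) :
    coeff hE R e m hm (term hE R e g hg r * x) =
      r * coeff hE R e (g.leftDiv m hmg) ((hE.repMor_leftDiv g m hmg).trans hg) x := by
  induction x using GroupoidRing.induction with
  | zero => simp
  | add x y hx hy => rw [mul_add, map_add, map_add, hx, hy, mul_add]
  | term e' h hh r' =>
    by_cases hgh : g.left = h.right
    · obtain rfl : e' = e := by rw [← hg, ← hh, hE.repMor_eq hgh]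
      rw [term_mul_term _ _ _ _ _ _ _ hgh]
      by_cases h1 : g.comp h hgh = m
      · subst h1
        rw [coeff_term_self, coeff_congr _ _ _ _ ((Mor.comp_eq_iff g h _ hgh hmg).mp rfl).symm,
          coeff_term_self]
      · rw [coeff_term_of_ne _ _ _ _ _ _ _ _ h1, coeff_term_of_ne, mul_zero]
        rwa [Ne, ← Mor.comp_eq_iff g h m hgh hmg]
    · rw [term_mul_term_of_ne _ _ _ _ _ _ _ _ hgh, map_zero, coeff_term_of_ne, mul_zero]
      rintro rfl
      exact hgh rfl

theorem coeff_term_mul_of_ne (e e' : E) (g m : Mor G) (hg : hE.repMor g = e')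
    (hm : hE.repMor m = e) (hmg : m.right ≠ g.right) (r : R e') (x : GroupoidRing hE R) :
    coeff hE R e m hm (term hE R e' g hg r * x) = 0 := by
  induction x using GroupoidRing.induction with
  | zero => simp
  | add x y hx hy => rw [mul_add, map_add, hx, hy, add_zero]
  | term e'' h hh r' =>
    by_cases hgh : g.left = h.right
    · obtain rfl : e'' = e' := by rw [← hg, ← hh, hE.repMor_eq hgh]
      rw [term_mul_term _ _ _ _ _ _ _ hgh, coeff_term_of_ne]
      rintro rfl
      exact hmg rfl
    · rw [term_mul_term_of_ne _ _ _ _ _ _ _ _ hgh, map_zero]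

/-! ### Left ideals cut out by coefficients and by domains -/

theorem isLeftIdeal_of_forall_term_mul_mem {I : AddSubgroup (GroupoidRing hE R)}
    (h : ∀ e g hg r, ∀ x ∈ I, term hE R e g hg r * x ∈ I) : IsLeftIdeal I := by
  intro s x hx
  induction s using GroupoidRing.induction with
  | zero => rw [zero_mul]; exact I.zero_mem
  | add s t hs ht => rw [add_mul]; exact I.add_mem hs ht
  | term e g hg r => exact h e g hg r x hx

/-- The elements of `R[G]` whose coefficients in `R e` all lie in `J`. -/
noncomputable def ofCoeffMem (e : E) (J : AddSubgroup (R e)) : AddSubgroup (GroupoidRing hE R) :=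
  ⨅ (g : Mor G) (hg : hE.repMor g = e), J.comap (coeff hE R e g hg)

theorem mem_ofCoeffMem {e : E} {J : AddSubgroup (R e)} {x : GroupoidRing hE R} :
    x ∈ ofCoeffMem hE R e J ↔ ∀ g hg, coeff hE R e g hg x ∈ J := by
  simp [ofCoeffMem, AddSubgroup.mem_iInf]

theorem isLeftIdeal_ofCoeffMem {e : E} {J : AddSubgroup (R e)} (hJ : IsLeftIdeal J) :
    IsLeftIdeal (ofCoeffMem hE R e J) := by
  refine isLeftIdeal_of_forall_term_mul_mem hE R fun e' g hg r x hx => ?_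
  rw [mem_ofCoeffMem] at hx ⊢
  intro m hm
  by_cases hmg : m.right = g.right
  · obtain rfl : e' = e := by rw [← hm, ← hg, hE.repMor_eq_of_right_eq hmg]
    rw [coeff_term_mul _ _ _ _ _ _ _ hmg]
    exact hJ _ _ (hx _ _)
  · rw [coeff_term_mul_of_ne _ _ _ _ _ _ _ _ hmg]
    exact J.zero_mem

theorem isLeftArtinian_coefficients (h : IsLeftArtinian (GroupoidRing hE R)) (e : E) :
    IsLeftArtinian (R e) := by
  have : WellFoundedLT {I : AddSubgroup (GroupoidRing hE R) // IsLeftIdeal I} := h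
  refine StrictMono.wellFoundedLT (f := fun J : {J : AddSubgroup (R e) // IsLeftIdeal J} =>
    (⟨ofCoeffMem hE R e J.1, isLeftIdeal_ofCoeffMem hE R J.2⟩ :
      {I : AddSubgroup (GroupoidRing hE R) // IsLeftIdeal I})) ?_
  intro J J' hlt
  obtain ⟨hle, hnle⟩ := hlt
  refine ⟨fun x hx => ?_, fun hle' => hnle fun r hr => ?_⟩
  · rw [mem_ofCoeffMem] at hx ⊢
    exact fun g hg => hle (hx g hg)
  -- Strictness is tested on `r` placed at the identity of `e`.
  · have hid : hE.repMor (Mor.id (e : G)) = e := hE.rep_coe e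
    have hx : term hE R e (Mor.id e) hid r ∈ ofCoeffMem hE R e J'.1 := by
      rw [mem_ofCoeffMem]
      intro g hg
      by_cases hge : Mor.id (e : G) = g
      · subst hge
        rwa [coeff_term_self]
      · rw [coeff_term_of_ne _ _ _ _ _ _ _ _ hge]
        exact J'.1.zero_mem
    have := (mem_ofCoeffMem hE R).mp (hle' hx) (Mor.id e) hid
    rwa [coeff_term_self] at this

/-- The elements of `R[G]` supported on morphisms with domain in `D`. -/
noncomputable def supportedOn (D : Set G) : AddSubgroup (GroupoidRing hE R) :=
  ⨅ (g : Mor G) (_ : g.left ∉ D), (coeff hE R (hE.repMor g) g rfl).ker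

theorem mem_supportedOn {D : Set G} {x : GroupoidRing hE R} :
    x ∈ supportedOn hE R D ↔ ∀ g e hg, g.left ∉ D → coeff hE R e g hg x = 0 := by
  simp only [supportedOn, AddSubgroup.mem_iInf, AddMonoidHom.mem_ker]
  refine ⟨fun h g e hg hgD => ?_, fun h g hgD => h g _ rfl hgD⟩
  subst hg
  exact h g hgD

/-- The domain of `g h` is that of `h`, so left multiplication does not change domains. -/
theorem isLeftIdeal_supportedOn (D : Set G) : IsLeftIdeal (supportedOn hE R D) := by
  refine isLeftIdeal_of_forall_term_mul_mem hE R fun e' g hg r x hx => ?_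
  rw [mem_supportedOn] at hx ⊢
  intro m e hm hmD
  by_cases hmg : m.right = g.right
  · obtain rfl : e' = e := by rw [← hm, ← hg, hE.repMor_eq_of_right_eq hmg]
    rw [coeff_term_mul _ _ _ _ _ _ _ hmg, hx (g.leftDiv m hmg) _ _ hmD, mul_zero]
  · rw [coeff_term_mul_of_ne _ _ _ _ _ _ _ _ hmg]

theorem strictMono_supportedOn [∀ e, Nontrivial (R e)] : StrictMono (supportedOn hE R) := by
  intro D D' hlt
  obtain ⟨hle, a, haD', haD⟩ := Set.ssubset_iff_exists.mp hlt
  refine ⟨fun x hx => ?_, fun hle' => ?_⟩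
  · rw [mem_supportedOn] at hx ⊢
    exact fun g e hg hgD => hx g e hg fun h => hgD (hle h)
  · have hx : term hE R (hE.repMor (Mor.id a)) (Mor.id a) rfl 1 ∈ supportedOn hE R D' := by
      rw [mem_supportedOn]
      intro g e hg hgD
      rw [coeff_term_of_ne]
      rintro rfl
      exact hgD haD'
    have h1 := (mem_supportedOn hE R).mp (hle' hx) (Mor.id a) _ rfl haD
    rw [coeff_term_self] at h1
    exact one_ne_zero h1

theorem finite_objects [∀ e, Nontrivial (R e)] (h : IsLeftArtinian (GroupoidRing hE R)) :
    Finite G := by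
  by_contra hinf
  rw [not_finite_iff_infinite] at hinf
  have : WellFoundedLT {I : AddSubgroup (GroupoidRing hE R) // IsLeftIdeal I} := h
  have hwf : WellFoundedLT (Set G) := StrictMono.wellFoundedLT
    (f := fun D : Set G => (⟨supportedOn hE R D, isLeftIdeal_supportedOn hE R D⟩ :
      {I : AddSubgroup (GroupoidRing hE R) // IsLeftIdeal I}))
    fun _ _ hlt => strictMono_supportedOn hE R hlt
  -- The tails of an infinite sequence of distinct objects form a strictly descending chain.
  let f := Infinite.natEmbedding G
  have hanti : StrictAnti fun n : ℕ => f '' Set.Ici n := fun m n hmn =>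
    f.injective.image_strictMono (Set.Ici_ssubset_Ici.mpr hmn)
  obtain ⟨n, hn⟩ := (wellFounded_lt (α := Set G)).has_min (Set.range fun n : ℕ => f '' Set.Ici n)
    (Set.range_nonempty _)
  obtain ⟨⟨k, rfl⟩, hmin⟩ := hn
  exact hmin _ ⟨k + 1, rfl⟩ (hanti k.lt_succ_self)

/-! ### Leading coefficients and the converse -/

/-- The possible coefficients at `g` of those elements of `I` all of whose coefficients after `g`,
with respect to the enumeration `σ`, vanish. -/
noncomputable def leadingCoeffs {n : ℕ} (σ : Mor G ≃ Fin n) (I : AddSubgroup (GroupoidRing hE R))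
    (g : Mor G) : AddSubgroup (R (hE.repMor g)) :=
  (I ⊓ ⨅ (h : Mor G) (_ : σ g < σ h), (coeff hE R (hE.repMor h) h rfl).ker).map
    (coeff hE R (hE.repMor g) g rfl)

theorem mem_leadingCoeffs {n : ℕ} {σ : Mor G ≃ Fin n} {I : AddSubgroup (GroupoidRing hE R)}
    {g : Mor G} {r : R (hE.repMor g)} :
    r ∈ leadingCoeffs hE R σ I g ↔ ∃ x ∈ I, (∀ h e hh, σ g < σ h → coeff hE R e h hh x = 0) ∧
      coeff hE R (hE.repMor g) g rfl x = r := by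
  simp only [leadingCoeffs, AddSubgroup.mem_map, AddSubgroup.mem_inf, AddSubgroup.mem_iInf,
    AddMonoidHom.mem_ker, and_assoc]
  refine exists_congr fun x => and_congr_right fun _ => and_congr_left fun _ =>
    ⟨fun h k e hk hgk => ?_, fun h k hgk => h k _ rfl hgk⟩
  subst hk
  exact h k hgk

/-- Left multiplication by `s` at the identity of the codomain of `g` multiplies each coefficient
with that codomain by `s` and kills the others, so no compatibility of `σ` with composition is
needed. -/
theorem isLeftIdeal_leadingCoeffs {n : ℕ} (σ : Mor G ≃ Fin n)
    {I : AddSubgroup (GroupoidRing hE R)} (hI : IsLeftIdeal I) (g : Mor G) :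
    IsLeftIdeal (leadingCoeffs hE R σ I g) := by
  intro s r hr
  rw [mem_leadingCoeffs] at hr ⊢
  obtain ⟨x, hx, hx0, rfl⟩ := hr
  have hid : hE.repMor (Mor.id g.right) = hE.repMor g := rfl
  refine ⟨term hE R (hE.repMor g) (Mor.id g.right) hid s * x, hI _ _ hx, fun h e hh hgh => ?_, ?_⟩
  · by_cases hr : h.right = (Mor.id g.right).right
    · obtain rfl : e = hE.repMor g := by rw [← hh, ← hE.repMor_eq_of_right_eq hr, hid]
      rw [coeff_term_mul _ _ _ _ _ _ _ hr, coeff_congr _ _ _ _ (Mor.id_leftDiv g.right h hr),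
        hx0 _ _ _ hgh, mul_zero]
    · rw [coeff_term_mul_of_ne _ _ _ _ _ _ _ _ hr]
  · have hr : g.right = (Mor.id g.right).right := rfl
    rw [coeff_term_mul _ _ _ _ _ _ _ hr, coeff_congr _ _ _ _ (Mor.id_leftDiv g.right g hr)]

theorem leadingCoeffs_mono {n : ℕ} (σ : Mor G ≃ Fin n) {I I' : AddSubgroup (GroupoidRing hE R)}
    (hII' : I ≤ I') (g : Mor G) : leadingCoeffs hE R σ I g ≤ leadingCoeffs hE R σ I' g :=
  AddSubgroup.map_mono (inf_le_inf_right _ hII')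

theorem le_of_leadingCoeffs_le {n : ℕ} (σ : Mor G ≃ Fin n) {I I' : AddSubgroup (GroupoidRing hE R)}
    (hII' : I ≤ I') (h : ∀ g, leadingCoeffs hE R σ I' g ≤ leadingCoeffs hE R σ I g) : I' ≤ I := by
  have key : ∀ k : ℕ, ∀ x ∈ I', (∀ g e hg, k ≤ (σ g : ℕ) → coeff hE R e g hg x = 0) → x ∈ I := by
    intro k
    induction k with
    | zero =>
      intro x _ hx
      obtain rfl : x = 0 := ext_coeff hE R fun g => by rw [hx _ _ _ (Nat.zero_le _), map_zero]
      exact I.zero_mem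
    | succ k ih =>
      intro x hx hx0
      by_cases hk : k < n
      · obtain ⟨g, hg⟩ := σ.surjective ⟨k, hk⟩
        have hg' : (σ g : ℕ) = k := by rw [hg]
        obtain ⟨y, hy, hy0, hyx⟩ := (mem_leadingCoeffs hE R).mp (h g
          ((mem_leadingCoeffs hE R).mpr ⟨x, hx, fun m e hm hgm => hx0 m e hm (by
            rw [Fin.lt_def, hg'] at hgm; exact hgm), rfl⟩))
        -- `y ∈ I` has the same last coefficient as `x`, so the difference vanishes from position
        -- `k` on.
        have hxy : x - y ∈ I := by
          refine ih _ (I'.sub_mem hx (hII' hy)) fun m e hm hkm => ?_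
          rcases hkm.eq_or_lt with hkm | hkm
          · obtain rfl : m = g := σ.injective (Fin.ext (by rw [hg', hkm]))
            subst hm
            rw [map_sub, hyx, sub_self]
          · rw [map_sub, hx0 _ _ _ hkm, hy0 _ _ _ (by rw [Fin.lt_def, hg']; exact hkm), sub_self]
        simpa using I.add_mem hxy hy
      · exact ih x hx fun g e hg hkg => absurd (hkg.trans_lt (σ g).2) hk
  exact fun x hx => key n x hx fun g e hg hng => absurd (σ g).2 hng.not_gt

theorem isLeftArtinian_of_finite [Finite (Mor G)] (h : ∀ e, IsLeftArtinian (R e)) :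
    IsLeftArtinian (GroupoidRing hE R) := by
  obtain ⟨n, ⟨σ⟩⟩ := Finite.exists_equiv_fin (Mor G)
  have (g : Mor G) : WellFoundedLT {J : AddSubgroup (R (hE.repMor g)) // IsLeftIdeal J} := h _
  refine StrictMono.wellFoundedLT (f := fun I : {I : AddSubgroup (GroupoidRing hE R) //
    IsLeftIdeal I} => fun g : Mor G => (⟨leadingCoeffs hE R σ I.1 g,
      isLeftIdeal_leadingCoeffs hE R σ I.2 g⟩ : {J : AddSubgroup (R (hE.repMor g)) //
        IsLeftIdeal J})) ?_
  exact fun I I' hlt => ⟨fun g => leadingCoeffs_mono hE R σ hlt.1 g,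
    fun hle => hlt.2 (le_of_leadingCoeffs_le hE R σ hlt.1 hle)⟩

/-! ### Finiteness of vertex groups and of `Mor G` -/

section VertexGroup

variable {F : Type*} [Field F] {a : G}

/-- The element `∑ φ(x_{kh}) h` of the group algebra of the vertex group at `a`, for an additive
map `φ` on the coefficients and a morphism `k` out of `a`. -/
noncomputable def vertexCoeff (φ : R (hE.rep a) →+ F) {b : G} (k : a ⟶ b) :
    GroupoidRing hE R →+ MonoidAlgebra F (End a) where
  toFun x := MonoidAlgebra.ofCoeff (Finsupp.ofSupportFinite
    (fun h : End a => φ (coeff hE R (hE.rep a) ⟨a, b, End.asHom h ≫ k⟩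
      (hE.repMor_mk _) x)) (by
    have hinj : Function.Injective fun h : End a => (⟨a, b, End.asHom h ≫ k⟩ : Mor G) := by
      intro h h' hh
      have hh' : End.asHom h ≫ k = End.asHom h' ≫ k := by simpa using hh
      exact (cancel_mono k).mp hh'
    refine ((finite_setOf_coeff_ne_zero hE R x).preimage hinj.injOn).subset ?_
    exact fun h hh => ⟨_, _, fun h0 => hh ((congrArg φ h0).trans (map_zero φ))⟩))
  map_zero' := by
    ext h
    exact (congrArg φ (map_zero _)).trans (map_zero φ)
  map_add' x y := by
    ext h
    exact (congrArg φ (map_add _ x y)).trans (map_add φ _ _)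

theorem vertexCoeff_coeff (φ : R (hE.rep a) →+ F) {b : G} (k : a ⟶ b) (x : GroupoidRing hE R)
    (h : End a) : (vertexCoeff hE R φ k x).coeff h =
      φ (coeff hE R (hE.rep a) ⟨a, b, End.asHom h ≫ k⟩ (hE.repMor_mk _) x) := rfl

theorem vertexCoeff_term_mul (φ : R (hE.rep a) →+ F) {b c : G} (k : a ⟶ b) (g : c ⟶ b)
    (hg : hE.repMor ⟨c, b, g⟩ = hE.rep a) (r : R (hE.rep a)) (x : GroupoidRing hE R) :
    vertexCoeff hE R φ k (term hE R (hE.rep a) ⟨c, b, g⟩ hg r * x) =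
      vertexCoeff hE R (φ.comp (AddMonoidHom.mulLeft r)) (k ≫ Groupoid.inv g) x := by
  ext h
  have hr : (Quiver.Total.mk a b (End.asHom h ≫ k)).right =
    (Quiver.Total.mk c b g).right := rfl
  have hm : Mor.leftDiv ⟨c, b, g⟩ ⟨a, b, End.asHom h ≫ k⟩ hr =
      ⟨a, c, End.asHom h ≫ k ≫ Groupoid.inv g⟩ := by
    simp [Mor.leftDiv]
  rw [vertexCoeff_coeff, vertexCoeff_coeff, coeff_term_mul _ _ _ _ _ _ _ hr,
    coeff_congr _ _ _ _ hm]
  rfl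

theorem vertexCoeff_term_mul_of_ne (φ : R (hE.rep a) →+ F) {b : G} (k : a ⟶ b) (g : Mor G)
    (e : E) (hg : hE.repMor g = e) (hbg : b ≠ g.right) (r : R e) (x : GroupoidRing hE R) :
    vertexCoeff hE R φ k (term hE R e g hg r * x) = 0 := by
  ext h
  have hr : (Quiver.Total.mk a b (End.asHom h ≫ k)).right ≠ g.right := hbg
  rw [vertexCoeff_coeff, coeff_term_mul_of_ne _ _ _ _ _ _ _ _ hr, map_zero]
  rfl

/-- The left ideal of `R[G]` of all `x` for which `vertexCoeff hE R φ k x ∈ I` for all `φ`, `k`. -/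
noncomputable def ofVertexIdeal (I : Ideal (MonoidAlgebra F (End a))) :
    AddSubgroup (GroupoidRing hE R) :=
  ⨅ (φ : R (hE.rep a) →+ F) (b : G) (k : a ⟶ b), I.toAddSubgroup.comap (vertexCoeff hE R φ k)

theorem mem_ofVertexIdeal {I : Ideal (MonoidAlgebra F (End a))} {x : GroupoidRing hE R} :
    x ∈ ofVertexIdeal hE R I ↔
      ∀ (φ : R (hE.rep a) →+ F) (b : G) (k : a ⟶ b), vertexCoeff hE R φ k x ∈ I := by
  simp [ofVertexIdeal, AddSubgroup.mem_iInf]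

/-- Left multiplication by `r` at `g` only replaces `φ` by `φ ∘ (r * ·)` and `k` by `g⁻¹ k`.
Quantifying over all `φ` and `k` absorbs this without associativity of the coefficients. -/
theorem isLeftIdeal_ofVertexIdeal (I : Ideal (MonoidAlgebra F (End a))) :
    IsLeftIdeal (ofVertexIdeal hE R I) := by
  refine isLeftIdeal_of_forall_term_mul_mem hE R fun e g hg r x hx => ?_
  rw [mem_ofVertexIdeal] at hx ⊢
  intro φ b k
  by_cases hbg : b = g.right
  · obtain ⟨c, d, g⟩ := g
    obtain rfl : b = d := hbg
    obtain rfl : hE.rep a = e := (hE.rep_eq_of_hom k).trans hg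
    rw [vertexCoeff_term_mul]
    exact hx _ _ _
  · rw [vertexCoeff_term_mul_of_ne _ _ _ _ _ _ _ hbg]
    exact I.zero_mem

theorem exists_forall_coeff_vertex_eq (s : Finset (End a)) (z : End a → ℤ)
    (hz : ∀ h ∉ s, z h = 0) : ∃ x : GroupoidRing hE R,
      (∀ h, coeff hE R (hE.rep a) ⟨a, a, End.asHom h⟩ (hE.repMor_mk _) x = z h • 1) ∧
      ∀ (e : E) (g : Mor G) (hg : hE.repMor g = e), g.right ≠ a → coeff hE R e g hg x = 0 := by
  refine ⟨∑ h ∈ s, term hE R (hE.rep a) ⟨a, a, End.asHom h⟩ (hE.repMor_mk _) (z h • 1), fun h => ?_,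
    fun e g hg hga => ?_⟩
  · rw [map_sum, Finset.sum_eq_single h]
    · exact coeff_term_self _ _ _ _ _ _
    · intro h' _ hne
      refine coeff_term_of_ne _ _ _ _ _ _ _ _ (fun heq => hne ?_) _
      simpa using heq
    · intro hh
      rw [hz h hh, zero_smul, map_zero, map_zero]
  · rw [map_sum]
    refine Finset.sum_eq_zero fun h _ => coeff_term_of_ne _ _ _ _ _ _ _ _ ?_ _
    rintro rfl
    exact hga rfl

/-- Only integer multiples of 1 lift from `F` to the coefficient ring, so `y ∈ I' \ I` is first
scaled by `n` to have integral coefficients, then lifted to `x`. -/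
theorem strictMono_ofVertexIdeal (hF : HasIntegralMultiples F) (φ : R (hE.rep a) →+ F)
    (hφ : φ 1 ≠ 0) :
    StrictMono fun I : Ideal (MonoidAlgebra F (End a)) => ofVertexIdeal hE R I := by
  classical
  intro I I' hlt
  obtain ⟨hle, y, hyI', hyI⟩ := SetLike.lt_iff_le_and_exists.mp hlt
  refine ⟨fun x hx => ?_, fun hle' => ?_⟩
  · rw [mem_ofVertexIdeal] at hx ⊢
    exact fun ψ b k => hle (hx ψ b k)
  obtain ⟨n, hn, hint⟩ := hF (y.coeff.support.image y.coeff)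
  have hint' : ∀ h, ∃ z : ℤ, n * y.coeff h = z ∧ (h ∉ y.coeff.support → z = 0) := by
    intro h
    by_cases hh : h ∈ y.coeff.support
    · obtain ⟨z, hz⟩ := hint _ (Finset.mem_image_of_mem _ hh)
      exact ⟨z, hz, fun h' => absurd hh h'⟩
    · exact ⟨0, by rw [Finsupp.notMem_support_iff.mp hh, mul_zero, Int.cast_zero], fun _ => rfl⟩
  choose z hz hz0 using hint'
  obtain ⟨x, hx, hx0⟩ := exists_forall_coeff_vertex_eq hE R y.coeff.support z hz0
  -- Every vertex coefficient of `x` along an endomorphism is a left multiple of `y`; here it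
  -- matters that `I'` is a left ideal.
  have hvx : ∀ (ψ : R (hE.rep a) →+ F) (k : End a), vertexCoeff hE R ψ (End.asHom k) x =
      MonoidAlgebra.single k⁻¹ (ψ 1 * n) * y := by
    intro ψ k
    ext h
    rw [vertexCoeff_coeff, MonoidAlgebra.coeff_single_mul_apply, inv_inv, mul_assoc, hz]
    refine (congrArg ψ (hx (k * h))).trans ?_
    rw [map_zsmul, zsmul_eq_mul, mul_comm]
  have hxI' : x ∈ ofVertexIdeal hE R I' := by
    rw [mem_ofVertexIdeal]
    intro ψ b k
    by_cases hab : b = a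
    · subst hab
      rw [show vertexCoeff hE R ψ k x = _ from hvx ψ k]
      exact I'.mul_mem_left _ hyI'
    · have : vertexCoeff hE R ψ k x = 0 := by
        ext h
        have hr : (Quiver.Total.mk a b (End.asHom h ≫ k)).right ≠ a := hab
        rw [vertexCoeff_coeff, hx0 _ _ _ hr, map_zero]
        rfl
      rw [this]
      exact I'.zero_mem
  -- With `φ` and the identity the multiple is by the nonzero scalar `φ 1 * n`, which can be
  -- inverted.
  have h1 := (mem_ofVertexIdeal hE R).mp (hle' hxI') φ a (End.asHom (1 : End a))
  rw [hvx, inv_one] at h1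
  refine hyI ?_
  have h2 := I.mul_mem_left (MonoidAlgebra.single 1 (φ 1 * n)⁻¹) h1
  rwa [← mul_assoc, MonoidAlgebra.single_mul_single, mul_one,
    inv_mul_cancel₀ (mul_ne_zero hφ hn), ← MonoidAlgebra.one_def, one_mul] at h2

end VertexGroup

theorem finite_end [∀ e, Nontrivial (R e)] (h : IsLeftArtinian (GroupoidRing hE R)) (a : G) :
    Finite (End a) := by
  obtain ⟨F, _, hF, φ, hφ⟩ := exists_addMonoidHom_field_map_one_ne_zero (R (hE.rep a))
  have : WellFoundedLT {I : AddSubgroup (GroupoidRing hE R) // IsLeftIdeal I} := h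
  have : IsArtinianRing (MonoidAlgebra F (End a)) := StrictMono.wellFoundedLT
    (f := fun I : Ideal (MonoidAlgebra F (End a)) =>
      (⟨ofVertexIdeal hE R I, isLeftIdeal_ofVertexIdeal hE R I⟩ :
        {I : AddSubgroup (GroupoidRing hE R) // IsLeftIdeal I}))
    fun _ _ hlt => strictMono_ofVertexIdeal hE R hF φ hφ hlt
  exact finite_of_isArtinianRing_monoidAlgebra F (End a)

theorem finite_mor [∀ e, Nontrivial (R e)] (h : IsLeftArtinian (GroupoidRing hE R)) :
    Finite (Mor G) := by
  have := finite_objects hE R h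
  have (a b : G) : Finite (a ⟶ b) := by
    rcases isEmpty_or_nonempty (a ⟶ b) with _ | ⟨⟨k⟩⟩
    · infer_instance
    · have := finite_end hE R h a
      refine Finite.of_injective (fun f : a ⟶ b => End.of (f ≫ Groupoid.inv k)) fun f f' hff => ?_
      simpa using (show f ≫ Groupoid.inv k = f' ≫ Groupoid.inv k from hff)
  refine Finite.of_injective (fun g : Mor G => (⟨g.left, g.right, g.hom⟩ : Σ a b : G, (a ⟶ b))) ?_
  rintro ⟨a, b, g⟩ ⟨a', b', g'⟩ hgg
  cases hgg
  rfl

theorem isLeftArtinian_iff [∀ e, Nontrivial (R e)] : IsLeftArtinian (GroupoidRing hE R) ↔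
    Finite (Mor G) ∧ ∀ e : E, IsLeftArtinian (R e) :=
  ⟨fun h => ⟨finite_mor hE R h, isLeftArtinian_coefficients hE R h⟩,
    fun ⟨_, h⟩ => isLeftArtinian_of_finite hE R h⟩

end GroupoidRing

/-! ### Right ideals through opposite rings -/

theorem isRightArtinian_iff_of_antiequiv {S T : Type*} [NonUnitalNonAssocRing S]
    [NonUnitalNonAssocRing T] (f : S ≃+ T) (hf : ∀ x y, f (x * y) = f y * f x) :
    IsRightArtinian S ↔ IsLeftArtinian T := by
  have hmap : ∀ I : AddSubgroup S, IsRightIdeal I → IsLeftIdeal (I.map f.toAddMonoidHom) := by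
    rintro I hI t _ ⟨x, hx, rfl⟩
    refine ⟨x * f.symm t, hI _ _ hx, ?_⟩
    exact (hf _ _).trans (by rw [f.apply_symm_apply]; rfl)
  have hcomap : ∀ J : AddSubgroup T, IsLeftIdeal J → IsRightIdeal (J.comap f.toAddMonoidHom) := by
    intro J hJ s x hx
    exact (congrArg (· ∈ J) (hf x s)).mpr (hJ _ _ hx)
  constructor
  · intro h
    have : WellFoundedLT {I : AddSubgroup S // IsRightIdeal I} := h
    refine StrictMono.wellFoundedLT (f := fun J : {J : AddSubgroup T // IsLeftIdeal J} =>
      (⟨J.1.comap f.toAddMonoidHom, hcomap _ J.2⟩ : {I : AddSubgroup S // IsRightIdeal I})) ?_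
    intro J J' hlt
    exact (AddSubgroup.comap_lt_comap_of_surjective (f := f.toAddMonoidHom) f.surjective).mpr hlt
  · intro h
    have : WellFoundedLT {J : AddSubgroup T // IsLeftIdeal J} := h
    refine StrictMono.wellFoundedLT (f := fun I : {I : AddSubgroup S // IsRightIdeal I} =>
      (⟨I.1.map f.toAddMonoidHom, hmap _ I.2⟩ : {J : AddSubgroup T // IsLeftIdeal J})) ?_
    intro I I' hlt
    exact (AddSubgroup.map_lt_map_iff_of_injective (f := f.toAddMonoidHom) f.injective).mpr hlt

theorem isRightArtinian_iff_isLeftArtinian_op (S : Type*) [NonUnitalNonAssocRing S] :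
    IsRightArtinian S ↔ IsLeftArtinian Sᵐᵒᵖ :=
  isRightArtinian_iff_of_antiequiv MulOpposite.opAddEquiv fun _ _ => rfl

namespace GroupoidRing

variable {G : Type u} [Groupoid.{v} G] {E : Set G} (hE : IsRepresentatives E)
  (R : E → Type w) [∀ e, NonAssocRing (R e)]

/-- The map `r δ_g ↦ r δ_{g⁻¹}` from `R[G]` to `Rᵐᵒᵖ[G]`. -/
noncomputable def toOp : GroupoidRing hE R →+ GroupoidRing hE fun e => (R e)ᵐᵒᵖ :=
  liftHom hE R fun g => (term hE (fun e => (R e)ᵐᵒᵖ) (hE.repMor g) g.inv (hE.repMor_inv g)).comp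
    MulOpposite.opAddEquiv.toAddMonoidHom

/-- The map `r δ_g ↦ r δ_{g⁻¹}` from `Rᵐᵒᵖ[G]` to `R[G]`. -/
noncomputable def ofOp : (GroupoidRing hE fun e => (R e)ᵐᵒᵖ) →+ GroupoidRing hE R :=
  liftHom hE (fun e => (R e)ᵐᵒᵖ) fun g => (term hE R (hE.repMor g) g.inv (hE.repMor_inv g)).comp
    MulOpposite.opAddEquiv.symm.toAddMonoidHom

theorem toOp_term (e : E) (g : Mor G) (hg : hE.repMor g = e) (r : R e) :
    toOp hE R (term hE R e g hg r) =
      term hE (fun e => (R e)ᵐᵒᵖ) e g.inv ((hE.repMor_inv g).trans hg) (MulOpposite.op r) := by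
  subst hg
  rw [term_rfl, toOp, liftHom_single]
  rfl

theorem ofOp_term (e : E) (g : Mor G) (hg : hE.repMor g = e) (r : (R e)ᵐᵒᵖ) :
    ofOp hE R (term hE (fun e => (R e)ᵐᵒᵖ) e g hg r) =
      term hE R e g.inv ((hE.repMor_inv g).trans hg) r.unop := by
  subst hg
  rw [term_rfl, ofOp, liftHom_single]
  rfl

theorem term_congr (e : E) {g h : Mor G} (hg : hE.repMor g = e) (hgh : g = h) (r : R e) :
    term hE R e g hg r = term hE R e h (hgh ▸ hg) r := by
  subst hgh
  rfl

theorem ofOp_toOp (x : GroupoidRing hE R) : ofOp hE R (toOp hE R x) = x := by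
  induction x using GroupoidRing.induction with
  | zero => rw [map_zero, map_zero]
  | add x y hx hy => rw [map_add, map_add, hx, hy]
  | term e g hg r => rw [toOp_term, ofOp_term, term_congr _ _ _ _ g.inv_inv, MulOpposite.unop_op]

theorem toOp_ofOp (x : GroupoidRing hE fun e => (R e)ᵐᵒᵖ) : toOp hE R (ofOp hE R x) = x := by
  induction x using GroupoidRing.induction with
  | zero => rw [map_zero, map_zero]
  | add x y hx hy => rw [map_add, map_add, hx, hy]
  | term e g hg r =>
    rw [ofOp_term, toOp_term, MulOpposite.op_unop]
    exact term_congr hE (fun e => (R e)ᵐᵒᵖ) e _ g.inv_inv r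

theorem toOp_mul (x y : GroupoidRing hE R) :
    toOp hE R (x * y) = toOp hE R y * toOp hE R x := by
  induction x using GroupoidRing.induction with
  | zero => rw [zero_mul, map_zero, mul_zero]
  | add x x' hx hx' => rw [add_mul, map_add, map_add, hx, hx', mul_add]
  | term e g hg r =>
    induction y using GroupoidRing.induction with
    | zero => rw [mul_zero, map_zero, zero_mul]
    | add y y' hy hy' => rw [mul_add, map_add, map_add, hy, hy', add_mul]
    | term e' h hh r' =>
      rw [toOp_term, toOp_term]
      by_cases hgh : g.left = h.right
      · obtain rfl : e' = e := by rw [← hg, ← hh, hE.repMor_eq hgh]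
        have hgh' : h.inv.left = g.inv.right := hgh.symm
        rw [term_mul_term _ _ _ _ _ _ _ hgh, toOp_term,
          term_mul_term _ _ _ _ _ _ _ hgh']
        exact term_congr hE (fun e => (R e)ᵐᵒᵖ) e' _ (Mor.inv_comp g h hgh) _
      · have hgh' : h.inv.left ≠ g.inv.right := fun h => hgh h.symm
        rw [term_mul_term_of_ne _ _ _ _ _ _ _ _ hgh, map_zero,
          term_mul_term_of_ne _ _ _ _ _ _ _ _ hgh']

theorem isRightArtinian_iff_isLeftArtinian_op : IsRightArtinian (GroupoidRing hE R) ↔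
    IsLeftArtinian (GroupoidRing hE fun e => (R e)ᵐᵒᵖ) :=
  isRightArtinian_iff_of_antiequiv
    { toOp hE R with
      invFun := ofOp hE R
      left_inv := ofOp_toOp hE R
      right_inv := toOp_ofOp hE R } (toOp_mul hE R)

end GroupoidRing

/-- The groupoid ring `R[G]` is left (right) artinian iff `mor(G)` is finite and every `R_e` is left
(right) artinian. Every `R_e` is a unital non-associative ring with nonzero identity. -/
theorem theorem4p1 {G : Type u} [Groupoid.{v} G] (E : Set G) (hE : IsRepresentatives E)
    (R : E → Type w) [∀ e, NonAssocRing (R e)] [∀ e, Nontrivial (R e)] :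
    (IsLeftArtinian (GroupoidRing hE R) ↔
      Finite (Mor G) ∧ ∀ e : E, IsLeftArtinian (R e)) ∧
    (IsRightArtinian (GroupoidRing hE R) ↔
      Finite (Mor G) ∧ ∀ e : E, IsRightArtinian (R e)) := by
  refine ⟨GroupoidRing.isLeftArtinian_iff hE R, ?_⟩
  simp_rw [GroupoidRing.isRightArtinian_iff_isLeftArtinian_op, GroupoidRing.isLeftArtinian_iff,
    isRightArtinian_iff_isLeftArtinian_op]
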